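/- Let $\mathcal X$ be a finite set. For a family $\mathcal F$ of functions $\mathcal X\to[0,1]$ and $s=(s_1,s_2)\in\mathbb N^2$, let $\mathcal F_s$ be the set of all $h:\mathcal X\to[0,1]$ for which there are $k\le s_1$ functions $f_1,\dots,f_k\in\mathcal F$ and a Boolean circuit with at most $s_2$ gates (constants, NOT, and fan-in-two AND and OR) which, given the binary digits of $f_1(x),\dots,f_k(x)$ as input bits, outputs $h(x)$ in binary for every $x\in\mathcal X$, that is, it has some number $m$ of output bits $c_1,\dots,c_m$ (each read off an input bit or a gate) with $h(x)=\sum_{i=1}^m c_i(x)/2^{i-1}$. For a probability distribution $\mathcal D$ on $\mathcal X$ and $g:\mathcal X\to[0,1]$, a function $h:\mathcal X\to[0,1]$ is *$(\mathcal F,\varepsilon)$-regular* (as a simulator for $g$ under $\mathcal D$) if $\bigl|\mathbb E_{x\sim\mathcal D}[f(x)(g(x)-h(x))]\bigr|\le\varepsilon$ for all $f\in\mathcal F$. Order $\mathbb N^2$ coordinatewise. **Theorem (Supersimulators, Expanding/Shrinking).** There are absolute constants $A,B,C>0$ and $p\in\mathbb N$ such that the following holds. For every finite set $\mathcal X$,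 every probability distribution $\mathcal D$ on $\mathcal X$, every family $\mathcal F$ of functions $\mathcal X\to[0,1]$, every $g:\mathcal X\to[0,1]$, every nonincreasing $\varepsilon:\mathbb N^2\to(0,1/2)$, every $\alpha\in(0,1/2)$ and every nondecreasing $G:\mathbb N^2\to\mathbb N^2$, there exist $s,s'\in\mathbb N^2$, $h\in\mathcal F_s$ and $h'\in\mathcal F_{s'}$ such that - (similarity) $\mathbb E_{x\sim\mathcal D}\bigl[(h(x)-h'(x))^2\bigr]\le\alpha+C\,\varepsilon(s)$; - (regularity) $h'$ is an $(\mathcal F_{G(s)},\varepsilon(s))$-regular simulator for $g$ under $\mathcal D$; - (complexity) $s,s'\le S_{\lfloor 1/\alpha\rfloor}$, where $S_0=(1,1)$ and $$S_{i+1}=\Bigl\lfloor \frac{A}{\varepsilon(S_i)^{2}}\,G(S_i)+\Bigl(0,\ \frac{B}{\varepsilon(S_i)^{3}}\,\bigl(\log_2\tfrac1{\varepsilon(S_i)}\bigr)^{p}\Bigr)\Bigr\rfloor ,$$ the floor being taken in each coordinate. -/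

import Mathlib

namespace Supersimulator

/-- A Boolean gate reading wires from `ω`: constants, negation, and fan-in-two conjunction and
disjunction. -/
inductive Gate (ω : Type*) where
  | const (b : Bool) : Gate ω
  | not (u : ω) : Gate ω
  | and (u v : ω) : Gate ω
  | or (u v : ω) : Gate ω

/-- The value of a gate under an assignment of bits to the wires. -/
def Gate.eval {ω : Type*} (v : ω → Bool) : Gate ω → Bool
  | .const b => b
  | .not u => !(v u)
  | .and u w => v u && v w
  | .or u w => v u || v w

/-- A Boolean circuit with input wires `ι` and exactly `n` gates, listed in topological order:
each gate reads input wires and outputs of earlier gates. -/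
inductive Circuit (ι : Type*) : ℕ → Type _ where
  | nil : Circuit ι 0
  | snoc {n : ℕ} (c : Circuit ι n) (γ : Gate (ι ⊕ Fin n)) : Circuit ι (n + 1)

/-- The bit carried by each wire (input wire or gate) of a circuit on a given input. -/
def Circuit.wire {ι : Type*} (z : ι → Bool) : {n : ℕ} → Circuit ι n → ι ⊕ Fin n → Bool
  | _, .nil => Sum.elim z Fin.elim0
  | _, .snoc c γ =>
      Sum.elim z (Fin.snoc (fun j => c.wire z (Sum.inr j)) (γ.eval (c.wire z)))

/-- The `j`-th binary digit, of weight `2 ^ (-j)`, of a number `y` in `[0, 1]`, in the terminating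
expansion when there is one. The digit of weight `1` is `true` only for `y = 1`. -/
noncomputable def digit (y : ℝ) (j : ℕ) : Bool :=
  decide (⌊2 ^ j * y⌋₊ % 2 = 1)

/-- The number `b₀ + b₁ / 2 + b₂ / 4 + ⋯` written in binary by finitely many bits. -/
noncomputable def ofBits {m : ℕ} (b : Fin m → Bool) : ℝ :=
  ∑ i : Fin m, (if b i then 1 else 0) / 2 ^ (i : ℕ)

variable {X : Type*}

/-- The class `F_s` for `s = (s₁, s₂)`: the functions `h : X → [0, 1]` for which there are at most
`s₁` functions `f₁, …, f_k` in `F` and a Boolean circuit with at most `s₂` gates that outputs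
`h x` in binary when its input wires carry the binary digits of `f₁ x, …, f_k x`. Each of the
`m` output bits is read off an arbitrary wire. -/
def simClass (F : Set (X → unitInterval)) (s : ℕ × ℕ) : Set (X → unitInterval) :=
  {h | ∃ k ≤ s.1, ∃ f : Fin k → X → unitInterval, (∀ i, f i ∈ F) ∧
    ∃ n ≤ s.2, ∃ (c : Circuit (Fin k × ℕ) n) (m : ℕ) (out : Fin m → (Fin k × ℕ) ⊕ Fin n),
      ∀ x, (h x : ℝ) = ofBits fun i => c.wire (fun p => digit (f p.1 x) p.2) (out i)}

/-- Expectation of `φ` under the probability vector `D` on the finite set `X`. -/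
def expect [Fintype X] (D : X → ℝ) (φ : X → ℝ) : ℝ :=
  ∑ x, D x * φ x

/-- `h` is an `(F, ε)`-regular simulator for `g` under `D`. -/
def IsRegular [Fintype X] (D : X → ℝ) (F : Set (X → unitInterval)) (ε : ℝ)
    (g h : X → unitInterval) : Prop :=
  ∀ f ∈ F, |expect D fun x => (f x : ℝ) * ((g x : ℝ) - h x)| ≤ ε

/-- The largest sequence `S` in `ℕ × ℕ` with `S 0 = (1, 1)` and, coordinatewise,
`S (i + 1) ≤ (A / ε(S i) ^ 2) • G (S i) + (0, B * (1 / ε(S i)) ^ 3 * log₂ (1 / ε(S i)) ^ p)`. -/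
noncomputable def sizeBound (A B : ℝ) (p : ℕ) (ε : ℕ × ℕ → ℝ) (G : ℕ × ℕ → ℕ × ℕ) : ℕ → ℕ × ℕ
  | 0 => (1, 1)
  | i + 1 =>
      let S := sizeBound A B p ε G i
      (⌊A / ε S ^ 2 * ((G S).1 : ℝ)⌋₊,
        ⌊A / ε S ^ 2 * ((G S).2 : ℝ) + B * (1 / ε S) ^ 3 * Real.logb 2 (1 / ε S) ^ p⌋₊)

end Supersimulator

/-!
The simulators are built by boosting, and one Boolean circuit is continued through all rounds.

*Distinguishers.* A function `f` in `simClass F s` is a binary number `∑ cᵢ / 2 ^ i` whose digits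
`cᵢ` are wires of a small circuit. If `f` has correlation more than `ε` with the error `g - h`, then
some single digit has correlation more than `ε / 2` (`abs_expect_ofBits_le`), so only Boolean
distinguishers matter.

*Corrections.* The current simulator is kept as a thermometer code: `h = N / 2 ^ q` with `2 ^ q` of
order `1 / ε`, and for each `j < 2 ^ q` there is a wire carrying `j < N x`. Adding a Boolean
distinguisher to `N`, or subtracting it, with the result cut off to `[0, 2 ^ q]`, costs
`O(1 / ε)` gates (`Holds.increment`, `Holds.decrement`) and lowers the potential `E (g - h) ^ 2` by
at least `ε ^ 2 / 8` (`Boosted.step`). Hence there are `O(1 / ε ^ 2)` corrections, with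
`O(1 / ε ^ 3)` gates of overhead in total; no logarithmic factor arises, and `p = 0` is possible.
A finer scale only repeats wires (`Holds.refine`), so that `ε` may change from round to round.

*Rounds.* Let `S` be the current size parameter, and correct the simulator `h` until no distinguisher
of size `G S` is left. The result `h'` has size at most `sizeStep ε G S`; this counts the
corrections of all rounds, since the earlier ones were cheaper and more effective
(`Boosted.refine`). In particular the size of `h` is not paid for again, and nothing like
`S ≤ G S` is needed. All wires of the circuit serve as distinguishers at no cost. As `h` and `h'`
are averages of wires, the error `g - h'` is nearly orthogonal to both, and the approximate
Pythagorean identity `expect_sq_sub_le` gives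
`E (h - h') ^ 2 ≤ E (g - h) ^ 2 - E (g - h') ^ 2 + 2 * ε S`.
So either `h` and `h'` are as required or the round lowers the potential by more than `α`.

*Counting.* The first simulator is the constant `1 / 2`, whose potential is at most `1 / 4`; hence
the first `⌊1 / α⌋ - 1` rounds cannot all fail. The constant takes two gates, which the first step of
`sizeBound` provides. Starting at `(0, 2)` also makes the sequence of size parameters monotone
(`iterate_sizeStep_mono`), whereas `sizeBound` itself, which starts at `(1, 1)`, need not be.
-/

namespace Supersimulator

/-! ### Circuits -/

/-- Renaming of the wires read by a gate. -/
def Gate.map {ω ω' : Type*} (φ : ω → ω') : Gate ω → Gate ω'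
  | .const b => .const b
  | .not u => .not (φ u)
  | .and u v => .and (φ u) (φ v)
  | .or u v => .or (φ u) (φ v)

theorem Gate.eval_map {ω ω' : Type*} (φ : ω → ω') (v : ω' → Bool) (γ : Gate ω) :
    (γ.map φ).eval v = γ.eval (v ∘ φ) := by
  cases γ <;> rfl

/-- Renaming of the input wires of a circuit. -/
def Circuit.map {ι κ : Type*} (φ : ι → κ) : {n : ℕ} → Circuit ι n → Circuit κ n
  | _, .nil => .nil
  | _, .snoc c γ => .snoc (c.map φ) (γ.map (Sum.map φ id))

@[simp]
theorem Circuit.wire_inl {ι : Type*} (z : ι → Bool) {n : ℕ} (c : Circuit ι n) (i : ι) :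
    c.wire z (Sum.inl i) = z i := by
  cases c <;> rfl

@[simp]
theorem Circuit.wire_snoc_last {ι : Type*} (z : ι → Bool) {n : ℕ} (c : Circuit ι n)
    (γ : Gate (ι ⊕ Fin n)) :
    (c.snoc γ).wire z (Sum.inr (Fin.last n)) = γ.eval (c.wire z) := by
  simp [Circuit.wire]

@[simp]
theorem Circuit.wire_snoc_castSucc {ι : Type*} (z : ι → Bool) {n : ℕ} (c : Circuit ι n)
    (γ : Gate (ι ⊕ Fin n)) (j : Fin n) :
    (c.snoc γ).wire z (Sum.inr j.castSucc) = c.wire z (Sum.inr j) := by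
  simp [Circuit.wire]

theorem Circuit.wire_snoc_map {ι : Type*} (z : ι → Bool) {n : ℕ} (c : Circuit ι n)
    (γ : Gate (ι ⊕ Fin n)) (w : ι ⊕ Fin n) :
    (c.snoc γ).wire z (Sum.map id Fin.castSucc w) = c.wire z w := by
  rcases w with i | j <;> simp

theorem Circuit.wire_map {ι κ : Type*} (φ : ι → κ) (z : κ → Bool) {n : ℕ} (c : Circuit ι n)
    (w : ι ⊕ Fin n) :
    (c.map φ).wire z (Sum.map φ id w) = c.wire (z ∘ φ) w := by
  induction c with
  | nil =>
    rcases w with i | j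
    · simp
    · exact j.elim0
  | snoc c γ ih =>
    rcases w with i | j
    · simp
    · refine Fin.lastCases ?_ (fun j => ?_) j
      · simp only [Circuit.map, Sum.map_inr, id, wire_snoc_last, Gate.eval_map]
        exact congrArg γ.eval (funext ih)
      · simpa [Circuit.map] using ih (Sum.inr j)

/-! ### Sets of Boolean functions carried by the wires of a circuit -/

variable {X : Type*}

/-- The function of `x` carried by a wire of a circuit that reads the digits of `f i x`. -/
noncomputable def wireFun {k n : ℕ} (f : Fin k → X → unitInterval) (c : Circuit (Fin k × ℕ) n)
    (w : (Fin k × ℕ) ⊕ Fin n) : X → Bool :=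
  fun x => c.wire (fun p => digit (f p.1 x) p.2) w

/-- All Boolean functions in `W` are carried by wires of one circuit that has at most `n` gates and
reads the digits of at most `k` functions from `F`. -/
def Computes (F : Set (X → unitInterval)) (k n : ℕ) (W : Set (X → Bool)) : Prop :=
  ∃ k' ≤ k, ∃ f : Fin k' → X → unitInterval, (∀ i, f i ∈ F) ∧
    ∃ n' ≤ n, ∃ c : Circuit (Fin k' × ℕ) n', W ⊆ Set.range (wireFun f c)

variable {F : Set (X → unitInterval)} {k k' n n' : ℕ} {W W' : Set (X → Bool)}

theorem Computes.mono (h : Computes F k n W) (hk : k ≤ k') (hn : n ≤ n') (hW : W' ⊆ W) :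
    Computes F k' n' W' := by
  obtain ⟨k₁, hk₁, f, hf, n₁, hn₁, c, hc⟩ := h
  exact ⟨k₁, hk₁.trans hk, f, hf, n₁, hn₁.trans hn, c, hW.trans hc⟩

theorem computes_empty : Computes F 0 0 (∅ : Set (X → Bool)) :=
  ⟨0, le_rfl, Fin.elim0, fun i => i.elim0, 0, le_rfl, .nil, Set.empty_subset _⟩

theorem Computes.gate {α : Type*} (h : Computes F k n W) (γ : Gate α) (v : α → X → Bool)
    (hv : ∀ a, v a ∈ W) :
    Computes F k (n + 1) (insert (fun x => γ.eval fun a => v a x) W) := by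
  obtain ⟨k₁, hk₁, f, hf, n₁, hn₁, c, hc⟩ := h
  choose w hw using fun a => hc (hv a)
  refine ⟨k₁, hk₁, f, hf, n₁ + 1, by omega, c.snoc (γ.map w), ?_⟩
  rintro b (rfl | hb)
  · refine ⟨Sum.inr (Fin.last _), funext fun x => ?_⟩
    simp only [wireFun, Circuit.wire_snoc_last, Gate.eval_map]
    exact congrArg γ.eval (funext fun a => congrFun (hw a) x)
  · obtain ⟨u, rfl⟩ := hc hb
    exact ⟨Sum.map id Fin.castSucc u, funext fun x => Circuit.wire_snoc_map _ _ _ _⟩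

/-- Reading the digits of further functions costs no gates. -/
theorem Computes.union_inputs (h : Computes F k n W) (f' : Fin k' → X → unitInterval)
    (hf' : ∀ i, f' i ∈ F) :
    Computes F (k + k') n (W ∪ Set.range fun p : Fin k' × ℕ => fun x => digit (f' p.1 x) p.2) := by
  obtain ⟨k₁, hk₁, f, hf, n₁, hn₁, c, hc⟩ := h
  refine ⟨k₁ + k', by omega, Fin.append f f', fun i => ?_, n₁, hn₁,
    c.map (Prod.map (Fin.castAdd k') id), ?_⟩
  · refine Fin.addCases (fun i => ?_) (fun i => ?_) i
    · simpa using hf i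
    · simpa using hf' i
  · rintro b (hb | ⟨p, rfl⟩)
    · obtain ⟨u, rfl⟩ := hc hb
      refine ⟨Sum.map (Prod.map (Fin.castAdd k') id) id u, funext fun x => ?_⟩
      simp only [wireFun, Circuit.wire_map]
      congr 1
      funext p
      simp
    · exact ⟨Sum.inl (Fin.natAdd k₁ p.1, p.2), funext fun x => by simp [wireFun]⟩

theorem Computes.union (h : Computes F k n W) (h' : Computes F k' n' W') :
    Computes F (k + k') (n + n') (W ∪ W') := by
  obtain ⟨k₁, hk₁, f, hf, n₁, hn₁, c, hc⟩ := h'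
  suffices key : Computes F (k + k₁) (n + n₁) (W ∪ Set.range (wireFun f c)) from
    key.mono (by omega) (by omega) (Set.union_subset_union_right _ hc)
  clear hc hn₁
  induction c with
  | nil =>
    refine (h.union_inputs f hf).mono le_rfl le_rfl (Set.union_subset_union_right _ ?_)
    rintro _ ⟨p | j, rfl⟩
    · exact ⟨p, rfl⟩
    · exact j.elim0
  | snoc c γ ih =>
    refine (ih.gate γ (wireFun f c) fun a => Or.inr ⟨a, rfl⟩).mono le_rfl le_rfl ?_
    rintro b (hb | ⟨p | j, rfl⟩)
    · exact Or.inr (Or.inl hb)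
    · exact Or.inr (Or.inr ⟨Sum.inl p, funext fun x => by simp [wireFun]⟩)
    · refine Fin.lastCases ?_ (fun j => ?_) j
      · exact Or.inl (funext fun x => by simp [wireFun])
      · exact Or.inr (Or.inr ⟨Sum.inr j, funext fun x => by simp [wireFun]⟩)

/-- `IsFormula W d b`: the function `b` is given by a Boolean formula with at most `d` connectives
and constants over the functions in `W`. -/
inductive IsFormula (W : Set (X → Bool)) : ℕ → (X → Bool) → Prop
  | mem {b : X → Bool} (hb : b ∈ W) : IsFormula W 0 b
  | const (a : Bool) : IsFormula W 1 fun _ => a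
  | not {d : ℕ} {b : X → Bool} (hb : IsFormula W d b) : IsFormula W (d + 1) fun x => !b x
  | and {d e : ℕ} {a b : X → Bool} (ha : IsFormula W d a) (hb : IsFormula W e b) :
      IsFormula W (d + e + 1) fun x => a x && b x
  | or {d e : ℕ} {a b : X → Bool} (ha : IsFormula W d a) (hb : IsFormula W e b) :
      IsFormula W (d + e + 1) fun x => a x || b x
  | le {d e : ℕ} {b : X → Bool} (hb : IsFormula W d b) (hde : d ≤ e) : IsFormula W e b

theorem Computes.formula {d : ℕ} {b : X → Bool} (hb : IsFormula W d b) :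
    ∀ {n : ℕ} {V : Set (X → Bool)}, W ⊆ V → Computes F k n V →
      ∃ V', V ⊆ V' ∧ b ∈ V' ∧ Computes F k (n + d) V' := by
  induction hb with
  | mem hb => exact fun hWV h => ⟨_, subset_rfl, hWV hb, h⟩
  | const a =>
    exact fun hWV h => ⟨_, Set.subset_insert _ _, Set.mem_insert _ _,
      h.gate (Gate.const a) Empty.elim fun a => a.elim⟩
  | not hb ih =>
    intro n V hWV h
    obtain ⟨V₁, h₁, hb₁, hc₁⟩ := ih hWV h
    exact ⟨_, h₁.trans (Set.subset_insert _ _), Set.mem_insert _ _,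
      hc₁.gate (Gate.not ()) (fun _ => _) fun _ => hb₁⟩
  | @and d e a b ha hb iha ihb =>
    intro n V hWV h
    obtain ⟨V₁, h₁, hb₁, hc₁⟩ := iha hWV h
    obtain ⟨V₂, h₂, hb₂, hc₂⟩ := ihb (hWV.trans h₁) hc₁
    refine ⟨_, (h₁.trans h₂).trans (Set.subset_insert _ _), Set.mem_insert _ _,
      (hc₂.gate (Gate.and true false) (fun t => cond t a b) ?_).mono le_rfl (by omega) subset_rfl⟩
    rintro (_ | _)
    exacts [hb₂, h₂ hb₁]
  | @or d e a b ha hb iha ihb =>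
    intro n V hWV h
    obtain ⟨V₁, h₁, hb₁, hc₁⟩ := iha hWV h
    obtain ⟨V₂, h₂, hb₂, hc₂⟩ := ihb (hWV.trans h₁) hc₁
    refine ⟨_, (h₁.trans h₂).trans (Set.subset_insert _ _), Set.mem_insert _ _,
      (hc₂.gate (Gate.or true false) (fun t => cond t a b) ?_).mono le_rfl (by omega) subset_rfl⟩
    rintro (_ | _)
    exacts [hb₂, h₂ hb₁]
  | le hb hde ih =>
    intro n V hWV h
    obtain ⟨V₁, h₁, hb₁, hc₁⟩ := ih hWV h
    exact ⟨V₁, h₁, hb₁, hc₁.mono le_rfl (by omega) subset_rfl⟩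

theorem Computes.formulas (h : Computes F k n W) {d : ℕ} {v : ℕ → X → Bool} (m : ℕ)
    (hv : ∀ j < m, IsFormula W d (v j)) :
    ∃ V, W ⊆ V ∧ (∀ j < m, v j ∈ V) ∧ Computes F k (n + m * d) V := by
  induction m with
  | zero => exact ⟨W, subset_rfl, by simp, h.mono le_rfl (by omega) subset_rfl⟩
  | succ m ih =>
    obtain ⟨V, hWV, hV, hc⟩ := ih fun j hj => hv j (by omega)
    obtain ⟨V', hVV', hm, hc'⟩ := Computes.formula (hv m (by omega)) hWV hc
    refine ⟨V', hWV.trans hVV', fun j hj => ?_, hc'.mono le_rfl (by rw [Nat.succ_mul]; omega)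
      subset_rfl⟩
    rcases Nat.lt_succ_iff_lt_or_eq.mp hj with hj | rfl
    exacts [hVV' (hV j hj), hm]

theorem Computes.mem_simClass (h : Computes F k n W) {s : ℕ × ℕ} (hk : k ≤ s.1) (hn : n ≤ s.2)
    {m : ℕ} {b : Fin m → X → Bool} (hb : ∀ i, b i ∈ W) {y : X → unitInterval}
    (hy : ∀ x, (y x : ℝ) = ofBits fun i => b i x) : y ∈ simClass F s := by
  obtain ⟨k₁, hk₁, f, hf, n₁, hn₁, c, hc⟩ := h
  choose out hout using fun i => hc (hb i)
  refine ⟨k₁, hk₁.trans hk, f, hf, n₁, hn₁.trans hn, c, m, out, fun x => ?_⟩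
  rw [hy x]
  congr 1
  funext i
  exact (congrFun (hout i) x).symm

theorem exists_computes_of_mem_simClass {s : ℕ × ℕ} {y : X → unitInterval}
    (hy : y ∈ simClass F s) :
    ∃ (m : ℕ) (b : Fin m → X → Bool), (∀ x, (y x : ℝ) = ofBits fun i => b i x) ∧
      Computes F s.1 s.2 (Set.range b) := by
  obtain ⟨k, hk, f, hf, n, hn, c, m, out, hy⟩ := hy
  refine ⟨m, fun i => wireFun f c (out i), hy, k, hk, f, hf, n, hn, c, ?_⟩
  rintro _ ⟨i, rfl⟩
  exact ⟨out i, rfl⟩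

/-- Any circuit computing `W` can be extended to compute `b` as well, reading at most `s.1` further
functions and adding at most `s.2` gates. -/
def Available (F : Set (X → unitInterval)) (s : ℕ × ℕ) (W : Set (X → Bool)) (b : X → Bool) :
    Prop :=
  ∀ k n, Computes F k n W → ∃ V, W ⊆ V ∧ b ∈ V ∧ Computes F (k + s.1) (n + s.2) V

theorem available_of_mem {s : ℕ × ℕ} {b : X → Bool} (hb : b ∈ W) : Available F s W b :=
  fun _ _ h => ⟨W, subset_rfl, hb, h.mono (by omega) (by omega) subset_rfl⟩

theorem Computes.available {s : ℕ × ℕ} {V : Set (X → Bool)} (h : Computes F s.1 s.2 V) {b : X → Bool}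
    (hb : b ∈ V) : Available F s W b :=
  fun _ _ h' => ⟨W ∪ V, Set.subset_union_left, Or.inr hb, h'.union h⟩

/-! ### Thermometer codes -/

/-- A circuit holding the thermometer code of the function `N / 2 ^ q`: for each `j < 2 ^ q` one of
its wires says whether `j < N x`. The set `W` consists of functions carried by its wires. -/
structure Holds (F : Set (X → unitInterval)) (q k n : ℕ) (W : Set (X → Bool)) (N : X → ℕ) :
    Prop where
  le : ∀ x, N x ≤ 2 ^ q
  computes : Computes F k n W
  mem : ∀ j < 2 ^ q, (fun x => decide (j < N x)) ∈ W

variable {q : ℕ} {N : X → ℕ}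

theorem Holds.mono (h : Holds F q k n W N) (hk : k ≤ k') (hn : n ≤ n') : Holds F q k' n' W N :=
  ⟨h.le, h.computes.mono hk hn subset_rfl, h.mem⟩

/-- Passing to a finer scale only repeats wires: `j < 2 ^ r * N` says that `j / 2 ^ r < N`. -/
theorem Holds.refine (h : Holds F q k n W N) (r : ℕ) :
    Holds F (q + r) k n W fun x => N x * 2 ^ r := by
  refine ⟨fun x => ?_, h.computes, fun j hj => ?_⟩
  · rw [pow_add]
    exact Nat.mul_le_mul_right _ (h.le x)
  · have hr : 0 < 2 ^ r := by positivity
    rw [pow_add] at hj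
    simpa only [Nat.div_lt_iff_lt_mul hr] using h.mem (j / 2 ^ r) ((Nat.div_lt_iff_lt_mul hr).2 hj)

theorem Holds.increment (h : Holds F q k n W N) {b : X → Bool} (hb : b ∈ W) :
    ∃ V, W ⊆ V ∧
      Holds F q k (n + 3 * 2 ^ q) V fun x => min (2 ^ q) (N x + if b x then 1 else 0) := by
  have hv : ∀ j < 2 ^ q, IsFormula W 3
      fun x => decide (j < min (2 ^ q) (N x + if b x then 1 else 0)) := by
    rintro (_ | j) hj
    · refine IsFormula.le (d := 1) ?_ (by omega)
      convert IsFormula.or (.mem (h.mem 0 hj)) (.mem hb) using 2 with x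
      cases b x <;> simp
    · refine IsFormula.le (d := 2) ?_ (by omega)
      convert IsFormula.or (.mem (h.mem (j + 1) hj))
        (.and (.mem hb) (.mem (h.mem j (by omega)))) using 2 with x
      cases b x
      · simp [hj]
      · simp only [lt_min_iff, hj, if_true, true_and, Bool.true_and, ← Bool.decide_or]
        exact decide_eq_decide.2 (by omega)
  obtain ⟨V, hWV, hV, hc⟩ := h.computes.formulas (2 ^ q) hv
  exact ⟨V, hWV, fun x => min_le_left _ _, by rwa [mul_comm 3], hV⟩

theorem Holds.decrement (h : Holds F q k n W N) {b : X → Bool} (hb : b ∈ W) :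
    ∃ V, W ⊆ V ∧
      Holds F q k (n + 3 * 2 ^ q) V fun x => N x - if b x then 1 else 0 := by
  have hv : ∀ j < 2 ^ q, IsFormula W 3
      fun x => decide (j < N x - if b x then 1 else 0) := by
    intro j hj
    by_cases hj' : j + 1 < 2 ^ q
    · refine IsFormula.le (d := 3) ?_ le_rfl
      convert IsFormula.and (.mem (h.mem j hj))
        (.or (.not (.mem hb)) (.mem (h.mem (j + 1) hj'))) using 2 with x
      cases b x
      · simp
      · simp only [if_true, Bool.not_true, Bool.false_or, ← Bool.decide_and]
        exact decide_eq_decide.2 (by omega)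
    · refine IsFormula.le (d := 2) ?_ (by omega)
      convert IsFormula.and (.mem (h.mem j hj)) (.not (.mem hb)) using 2 with x
      cases b x
      · simp
      · have := h.le x
        simp
        omega
  obtain ⟨V, hWV, hV, hc⟩ := h.computes.formulas (2 ^ q) hv
  exact ⟨V, hWV, fun x => (Nat.sub_le _ _).trans (h.le x), by rwa [mul_comm 3], hV⟩

/-- Every Boolean function of `N` has a formula of size linear in `2 ^ q`, obtained by computing
`P (min (N x) t)` for successive `t`. -/
theorem Holds.isFormula_comp (h : Holds F q k n W N) (P : ℕ → Bool) :
    IsFormula W (2 * 2 ^ q + 1) fun x => P (N x) := by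
  have key : ∀ t ≤ 2 ^ q, IsFormula W (2 * t + 1) fun x => P (min (N x) t) := by
    intro t
    induction t with
    | zero => exact fun _ => by simpa using IsFormula.const (W := W) (P 0)
    | succ t ih =>
      intro ht
      have hN : ∀ x, min (N x) (t + 1) = if t < N x then t + 1 else min (N x) t := by
        intro x
        split_ifs <;> omega
      cases hP : P (t + 1)
      · refine IsFormula.le (d := 0 + 1 + (2 * t + 1) + 1) ?_ (by omega)
        convert IsFormula.and (.not (.mem (h.mem t ht))) (ih (by omega)) using 2 with x
        rw [hN]
        by_cases hx : t < N x <;> simp [hx, hP]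
      · refine IsFormula.le (d := 0 + (2 * t + 1) + 1) ?_ (by omega)
        convert IsFormula.or (.mem (h.mem t ht)) (ih (by omega)) using 2 with x
        rw [hN]
        by_cases hx : t < N x <;> simp [hx, hP]
  simpa only [min_eq_left (h.le _)] using key _ le_rfl

theorem ofBits_testBit (q : ℕ) : ∀ N : ℕ, N < 2 ^ (q + 1) →
    ofBits (fun i : Fin (q + 1) => N.testBit (q - i)) = (N : ℝ) / 2 ^ q := by
  induction q with
  | zero =>
    intro N hN
    have : N < 2 := by simpa using hN
    interval_cases N <;> simp [ofBits]
  | succ q ih =>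
    intro N hN
    have h2 := ih (N / 2) (by rw [pow_succ] at hN; omega)
    have hmod : (if N.testBit 0 then 1 else 0 : ℝ) = ((N % 2 : ℕ) : ℝ) := by
      rcases Nat.mod_two_eq_zero_or_one N with h | h <;> simp [Nat.testBit_zero, h]
    have hdiv : (N : ℝ) = 2 * ((N / 2 : ℕ) : ℝ) + ((N % 2 : ℕ) : ℝ) := by
      exact_mod_cast (Nat.div_add_mod N 2).symm
    unfold ofBits at h2 ⊢
    rw [Fin.sum_univ_castSucc]
    have hrest : ∀ i : Fin (q + 1), N.testBit (q + 1 - (i : ℕ)) = (N / 2).testBit (q - i) := by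
      intro i
      rw [show q + 1 - (i : ℕ) = (q - i) + 1 by omega, Nat.testBit_succ]
    simp only [Fin.val_castSucc, hrest, h2, Fin.val_last, Nat.sub_self, hmod]
    rw [hdiv, pow_succ]
    field_simp

theorem Holds.mem_simClass (h : Holds F q k n W N) {s : ℕ × ℕ} (hk : k ≤ s.1)
    (hn : n + 3 * (2 ^ q * 2 ^ q) ≤ s.2) {y : X → unitInterval}
    (hy : ∀ x, (y x : ℝ) = N x / 2 ^ q) : y ∈ simClass F s := by
  obtain ⟨V, -, hV, hc⟩ := h.computes.formulas (v := fun i x => (N x).testBit (q - i)) (q + 1)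
    fun i _ => h.isFormula_comp fun a => a.testBit (q - i)
  refine hc.mem_simClass hk (hn.trans' ?_) (b := fun i : Fin (q + 1) => fun x =>
    (N x).testBit (q - i)) (fun i => hV i i.2) fun x => ?_
  · have hq : q + 1 ≤ 2 ^ q := Nat.lt_two_pow_self
    have : 1 ≤ 2 ^ q := Nat.one_le_two_pow
    have := Nat.mul_le_mul hq (show 2 * 2 ^ q + 1 ≤ 3 * 2 ^ q by omega)
    calc n + (q + 1) * (2 * 2 ^ q + 1) ≤ n + 2 ^ q * (3 * 2 ^ q) := by omega
      _ = n + 3 * (2 ^ q * 2 ^ q) := by ring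
  · rw [ofBits_testBit q (N x) ((h.le x).trans_lt (Nat.pow_lt_pow_right one_lt_two q.lt_succ_self)),
      hy]

end Supersimulator

namespace Supersimulator

/-! ### The potential -/

variable {X : Type*} [Fintype X] {D : X → ℝ}

theorem expect_mono (hD : D ∈ stdSimplex ℝ X) {φ ψ : X → ℝ} (h : ∀ x, φ x ≤ ψ x) :
    expect D φ ≤ expect D ψ :=
  Finset.sum_le_sum fun x _ => mul_le_mul_of_nonneg_left (h x) (hD.1 x)

theorem expect_add (D φ ψ : X → ℝ) :
    expect D (fun x => φ x + ψ x) = expect D φ + expect D ψ := by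
  simp [expect, mul_add, Finset.sum_add_distrib]

theorem expect_smul (D φ : X → ℝ) (a : ℝ) : expect D (fun x => a * φ x) = a * expect D φ := by
  simp only [expect, Finset.mul_sum]
  exact Finset.sum_congr rfl fun x _ => by ring

theorem expect_const (hD : D ∈ stdSimplex ℝ X) (a : ℝ) : expect D (fun _ => a) = a := by
  simp [expect, ← Finset.sum_mul, hD.2]

theorem expect_sum {ι : Type*} (D : X → ℝ) (s : Finset ι) (φ : ι → X → ℝ) :
    expect D (fun x => ∑ i ∈ s, φ i x) = ∑ i ∈ s, expect D (φ i) := by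
  simp only [expect, Finset.mul_sum]
  exact Finset.sum_comm

/-- The correlation of a Boolean function with the error of the simulator `N / 2 ^ q` for `g`. -/
noncomputable def corr (D : X → ℝ) (g : X → unitInterval) (q : ℕ) (N : X → ℕ) (b : X → Bool) : ℝ :=
  expect D fun x => (if b x then 1 else 0) * ((g x : ℝ) - N x / 2 ^ q)

/-- The mean squared error of the simulator `N / 2 ^ q` for `g`. -/
noncomputable def potential (D : X → ℝ) (g : X → unitInterval) (q : ℕ) (N : X → ℕ) : ℝ :=
  expect D fun x => ((g x : ℝ) - N x / 2 ^ q) ^ 2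

variable {g : X → unitInterval} {q : ℕ} {N : X → ℕ} {ε : ℝ}

theorem potential_nonneg (hD : D ∈ stdSimplex ℝ X) : 0 ≤ potential D g q N :=
  Finset.sum_nonneg fun x _ => mul_nonneg (hD.1 x) (sq_nonneg _)

theorem potential_refine (r : ℕ) :
    potential D g (q + r) (fun x => N x * 2 ^ r) = potential D g q N := by
  have : ∀ x, ((N x * 2 ^ r : ℕ) : ℝ) / 2 ^ (q + r) = N x / 2 ^ q := by
    intro x
    rw [pow_add]
    push_cast
    field_simp
  simp only [potential, this]

theorem potential_le_of_pointwise (hD : D ∈ stdSimplex ℝ X) {N' : X → ℕ} {b : X → Bool} {a c : ℝ}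
    (h : ∀ x, ((g x : ℝ) - N' x / 2 ^ q) ^ 2 ≤ ((g x : ℝ) - N x / 2 ^ q) ^ 2 +
      (a * ((if b x then 1 else 0) * ((g x : ℝ) - N x / 2 ^ q)) + c)) :
    potential D g q N' ≤ potential D g q N + (a * corr D g q N b + c) := by
  refine (expect_mono hD h).trans_eq ?_
  rw [expect_add, expect_add, expect_smul, expect_const hD]
  rfl

theorem potential_increment_le (hD : D ∈ stdSimplex ℝ X) (hN : ∀ x, N x ≤ 2 ^ q) (b : X → Bool) :
    potential D g q (fun x => min (2 ^ q) (N x + if b x then 1 else 0)) ≤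
      potential D g q N + (-2 * (1 / 2 ^ q) * corr D g q N b + (1 / 2 ^ q) ^ 2) := by
  refine potential_le_of_pointwise hD fun x => ?_
  have hq : (0 : ℝ) < 1 / 2 ^ q := by positivity
  have hg := (g x).2.2
  cases b x
  · simp only [Bool.false_eq_true, if_false, add_zero, min_eq_right (hN x)]
    nlinarith
  · rcases (hN x).lt_or_eq with h | h
    · simp only [if_true, min_eq_right (Nat.succ_le_of_lt h)]
      push_cast
      rw [add_div]
      nlinarith
    · -- the increment is cut off at the value `1`, which is at least `g x`
      simp only [if_true, h, min_eq_left (Nat.le_succ _)]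
      push_cast
      rw [div_self (by positivity)]
      nlinarith

theorem potential_decrement_le (hD : D ∈ stdSimplex ℝ X) (b : X → Bool) :
    potential D g q (fun x => N x - if b x then 1 else 0) ≤
      potential D g q N + (2 * (1 / 2 ^ q) * corr D g q N b + (1 / 2 ^ q) ^ 2) := by
  refine potential_le_of_pointwise hD fun x => ?_
  have hq : (0 : ℝ) < 1 / 2 ^ q := by positivity
  have hg := (g x).2.1
  cases b x
  · simp only [Bool.false_eq_true, if_false, Nat.sub_zero]
    nlinarith
  · rcases (N x).eq_zero_or_pos with h | h
    · -- the decrement is cut off at the value `0`, which is at most `g x`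
      simp only [if_true, h, Nat.zero_sub, Nat.cast_zero, zero_div, sub_zero, one_mul]
      have := mul_nonneg hq.le hg
      nlinarith [sq_nonneg (1 / 2 ^ q : ℝ)]
    · simp only [if_true, Nat.cast_sub (show 1 ≤ N x from h)]
      push_cast
      rw [sub_div]
      nlinarith

/-- A function that is the average of its thermometer bits is no better a distinguisher than they
are. -/
theorem abs_expect_thermometer_le {q' : ℕ} {M : X → ℕ} (hM : ∀ x, M x ≤ 2 ^ q')
    (h : ∀ j < 2 ^ q', |corr D g q N fun x => decide (j < M x)| ≤ ε) :
    |expect D fun x => (M x / 2 ^ q' : ℝ) * ((g x : ℝ) - N x / 2 ^ q)| ≤ ε := by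
  have hsum : ∀ x, (M x / 2 ^ q' : ℝ) * ((g x : ℝ) - N x / 2 ^ q) = (1 / 2 ^ q') *
      ∑ j ∈ Finset.range (2 ^ q'),
        (if decide (j < M x) then 1 else 0) * ((g x : ℝ) - N x / 2 ^ q) := by
    intro x
    have hf : (Finset.range (2 ^ q')).filter (· < M x) = Finset.range (M x) := by
      ext j
      have := hM x
      simp only [Finset.mem_filter, Finset.mem_range]
      omega
    rw [← Finset.sum_mul]
    simp only [decide_eq_true_eq, Finset.sum_boole, hf, Finset.card_range]
    ring
  simp only [hsum, expect_smul, expect_sum]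
  rw [abs_mul, abs_of_pos (by positivity)]
  have := (Finset.abs_sum_le_sum_abs _ _).trans (Finset.sum_le_card_nsmul _ _ _
    fun j hj => h j (Finset.mem_range.1 hj))
  rw [Finset.card_range, nsmul_eq_mul] at this
  push_cast at this
  rw [one_div, inv_mul_le_iff₀ (by positivity)]
  exact this

/-- A binary number whose digits all have correlation at most `ε / 2` with the error has
correlation at most `ε`, because the weights `1, 1/2, 1/4, …` sum to at most `2`. -/
theorem abs_expect_ofBits_le (hε : 0 ≤ ε) {m : ℕ} (b : Fin m → X → Bool)
    (h : ∀ i, |corr D g q N (b i)| ≤ ε / 2) :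
    |expect D fun x => (ofBits fun i => b i x) * ((g x : ℝ) - N x / 2 ^ q)| ≤ ε := by
  have hsum : ∀ x, (ofBits fun i => b i x) * ((g x : ℝ) - N x / 2 ^ q) =
      ∑ i : Fin m, (1 / 2 : ℝ) ^ (i : ℕ) *
        ((if b i x then 1 else 0) * ((g x : ℝ) - N x / 2 ^ q)) := by
    intro x
    rw [ofBits, Finset.sum_mul]
    refine Finset.sum_congr rfl fun i _ => ?_
    rw [one_div, inv_pow]
    ring
  simp only [hsum, expect_smul, expect_sum]
  calc _ ≤ ∑ i : Fin m, |(1 / 2 : ℝ) ^ (i : ℕ) * corr D g q N (b i)| :=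
        Finset.abs_sum_le_sum_abs _ _
    _ ≤ ∑ i : Fin m, (1 / 2 : ℝ) ^ (i : ℕ) * (ε / 2) := by
        refine Finset.sum_le_sum fun i _ => ?_
        rw [abs_mul, abs_of_pos (by positivity)]
        exact mul_le_mul_of_nonneg_left (h i) (by positivity)
    _ = (∑ i ∈ Finset.range m, (1 / 2 : ℝ) ^ i) * (ε / 2) := by
        rw [← Finset.sum_mul, Fin.sum_univ_eq_sum_range fun i => (1 / 2 : ℝ) ^ i]
    _ ≤ 2 * (ε / 2) := mul_le_mul_of_nonneg_right (sum_geometric_two_le m) (by linarith)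
    _ = ε := by ring

/-! ### Boosting -/

variable {F : Set (X → unitInterval)} {k n t : ℕ} {W : Set (X → Bool)} {s : ℕ × ℕ}

/-- The state of the boosting procedure with parameters `s` and `ε` after at most `t` corrections:
each correction reads at most `s.1` further functions and adds at most `s.2` gates for the
distinguisher and `3 * 2 ^ q` gates for the update, and lowers the potential by `ε ^ 2 / 8` from its
initial value, which is at most `1 / 4`. -/
structure Boosted (D : X → ℝ) (g : X → unitInterval) (F : Set (X → unitInterval)) (s : ℕ × ℕ)
    (ε : ℝ) (q t : ℕ) (W : Set (X → Bool)) (N : X → ℕ) : Prop where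
  holds : Holds F q (t * s.1) (2 + t * (s.2 + 3 * 2 ^ q)) W N
  drop : t * (ε ^ 2 / 8) ≤ 1 / 4 - potential D g q N

theorem Boosted.step (hD : D ∈ stdSimplex ℝ X) (hε : 0 < ε) (hq : 2 / ε ≤ 2 ^ q)
    (hq' : (2 : ℝ) ^ q ≤ 4 / ε) (h : Boosted D g F s ε q t W N) {b : X → Bool}
    (hb : Available F s W b) (hc : ε / 2 < |corr D g q N b|) :
    ∃ V N', W ⊆ V ∧ Boosted D g F s ε q (t + 1) V N' := by
  obtain ⟨V, hWV, hbV, hV⟩ := hb _ _ h.holds.computes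
  have hh : Holds F q (t * s.1 + s.1) (2 + t * (s.2 + 3 * 2 ^ q) + s.2) V N :=
    ⟨h.holds.le, hV, fun j hj => hWV (h.holds.mem j hj)⟩
  set η : ℝ := 1 / 2 ^ q with hη
  have hη1 : η ≤ ε / 2 := by
    rw [hη, div_le_iff₀ (by positivity)]
    rw [div_le_iff₀ hε] at hq
    linarith
  have hη2 : ε / 4 ≤ η := by
    rw [hη, le_div_iff₀ (by positivity)]
    rw [le_div_iff₀ hε] at hq'
    linarith
  have hdrop := h.drop
  rcases lt_abs.1 hc with hc | hc
  · obtain ⟨V', hVV', hV'⟩ := hh.increment hbV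
    refine ⟨V', _, hWV.trans hVV', hV'.mono (by linarith) (by linarith), ?_⟩
    have := potential_increment_le (g := g) hD hh.le b
    rw [← hη] at this
    push_cast
    nlinarith
  · obtain ⟨V', hVV', hV'⟩ := hh.decrement hbV
    refine ⟨V', _, hWV.trans hVV', hV'.mono (by linarith) (by linarith), ?_⟩
    have := potential_decrement_le (g := g) (q := q) (N := N) hD b
    rw [← hη] at this
    push_cast
    nlinarith

theorem Boosted.steps_le (hD : D ∈ stdSimplex ℝ X) (hε : 0 < ε) (h : Boosted D g F s ε q t W N) :
    (t : ℝ) ≤ 2 / ε ^ 2 := by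
  have := h.drop
  have := potential_nonneg (g := g) (q := q) (N := N) hD
  rw [le_div_iff₀ (by positivity)]
  linarith

/-- Boosting ends at a simulator that no available Boolean function distinguishes from `g`: a state
with the largest possible number of corrections admits no further one. -/
theorem Boosted.exists_corr_le (hD : D ∈ stdSimplex ℝ X) (hε : 0 < ε) (hq : 2 / ε ≤ 2 ^ q)
    (hq' : (2 : ℝ) ^ q ≤ 4 / ε) (h : Boosted D g F s ε q t W N) :
    ∃ t' V N', W ⊆ V ∧ Boosted D g F s ε q t' V N' ∧
      ∀ b, Available F s V b → |corr D g q N' b| ≤ ε / 2 := by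
  by_contra! hcon
  have key : ∀ r, ∃ V N', W ⊆ V ∧ Boosted D g F s ε q (t + r) V N' := by
    intro r
    induction r with
    | zero => exact ⟨W, N, subset_rfl, h⟩
    | succ r ih =>
      obtain ⟨V, N', hWV, hV⟩ := ih
      obtain ⟨b, hb, hbc⟩ := hcon _ V N' hWV hV
      obtain ⟨V', N'', hVV', hV'⟩ := hV.step hD hε hq hq' hb hbc
      exact ⟨V', N'', hWV.trans hVV', hV'⟩
  obtain ⟨r, hr⟩ := exists_nat_gt (2 / ε ^ 2)
  obtain ⟨V, N', -, hV⟩ := key r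
  have := hV.steps_le hD hε
  push_cast at this
  have : (0 : ℝ) ≤ t := t.cast_nonneg
  linarith

/-- The simulator `N / 2 ^ q` as a function into the unit interval. -/
noncomputable def Holds.simulator (h : Holds F q k n W N) (x : X) : unitInterval :=
  ⟨N x / 2 ^ q, by positivity, div_le_one_of_le₀ (by exact_mod_cast h.le x) (by positivity)⟩

theorem isRegular_of_corr_le (hε : 0 < ε) (h : Holds F q k n W N)
    (hc : ∀ b, Available F s W b → |corr D g q N b| ≤ ε / 2) :
    IsRegular D (simClass F s) ε g h.simulator := by
  intro f hf
  obtain ⟨m, b, hb, hbc⟩ := exists_computes_of_mem_simClass hf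
  simp only [hb]
  exact abs_expect_ofBits_le hε.le b fun i => hc _ (hbc.available ⟨i, rfl⟩)

/-- The approximate Pythagorean identity: since the error of the new simulator `N'` is nearly
orthogonal to `N` and `N'`, the potential falls by almost the squared distance moved. -/
theorem expect_sq_sub_le {k' n' q' : ℕ} {V : Set (X → Bool)} {N' : X → ℕ}
    (h : Holds F q k n W N) (h' : Holds F q' k' n' V N') (hWV : W ⊆ V)
    (hc : ∀ b ∈ V, |corr D g q' N' b| ≤ ε / 2) :
    expect D (fun x => ((h.simulator x : ℝ) - h'.simulator x) ^ 2) ≤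
      potential D g q N - potential D g q' N' + 2 * ε := by
  have h₁ := abs_expect_thermometer_le h.le fun j hj => hc _ (hWV (h.mem j hj))
  have h₂ := abs_expect_thermometer_le h'.le fun j hj => hc _ (h'.mem j hj)
  have key : expect D (fun x => ((h.simulator x : ℝ) - h'.simulator x) ^ 2) +
      potential D g q' N' =
      potential D g q N +
      (2 * (expect D fun x => (N x / 2 ^ q : ℝ) * ((g x : ℝ) - N' x / 2 ^ q')) +
      -2 * (expect D fun x => (N' x / 2 ^ q' : ℝ) * ((g x : ℝ) - N' x / 2 ^ q'))) := by
    simp only [potential, ← expect_smul, ← expect_add]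
    congr 1
    funext x
    simp only [Holds.simulator]
    ring
  have := (abs_le.1 h₁).2
  have := (abs_le.1 h₂).1
  linarith

end Supersimulator

namespace Supersimulator

/-! ### The sequence of size bounds -/

/-- The recursion step of `sizeBound` with `A = 2`, `B = 50` and `p = 0`. -/
noncomputable def sizeStep (ε : ℕ × ℕ → ℝ) (G : ℕ × ℕ → ℕ × ℕ) (S : ℕ × ℕ) : ℕ × ℕ :=
  (⌊2 / ε S ^ 2 * ((G S).1 : ℝ)⌋₊,
    ⌊2 / ε S ^ 2 * ((G S).2 : ℝ) + 50 * (1 / ε S) ^ 3 * Real.logb 2 (1 / ε S) ^ 0⌋₊)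

section Sizes

variable {ε : ℕ × ℕ → ℝ} {G : ℕ × ℕ → ℕ × ℕ}

theorem sizeBound_succ (i : ℕ) :
    sizeBound 2 50 0 ε G (i + 1) = sizeStep ε G (sizeBound 2 50 0 ε G i) := rfl

theorem sizeStep_mono (hε : ∀ t, ε t ∈ Set.Ioo (0 : ℝ) (1 / 2)) (hanti : Antitone ε)
    (hG : Monotone G) : Monotone (sizeStep ε G) := by
  intro S S' h
  have h0 := (hε S).1
  have h0' := (hε S').1
  have hle := hanti h
  have h1 : ((G S).1 : ℝ) ≤ (G S').1 := by exact_mod_cast (hG h).1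
  have h2 : ((G S).2 : ℝ) ≤ (G S').2 := by exact_mod_cast (hG h).2
  constructor
  · refine Nat.floor_mono ?_
    gcongr
  · refine Nat.floor_mono ?_
    simp only [pow_zero, mul_one]
    gcongr

theorem le_sizeStep (hε : ∀ t, ε t ∈ Set.Ioo (0 : ℝ) (1 / 2)) (S : ℕ × ℕ) :
    ((0, 2) : ℕ × ℕ) ≤ sizeStep ε G S := by
  have h0 := (hε S).1
  have h2 : (2 : ℝ) ≤ 1 / ε S := by
    rw [le_div_iff₀ h0]
    linarith [(hε S).2]
  refine ⟨Nat.zero_le _, Nat.le_floor ?_⟩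
  have h3 : (2 : ℝ) ^ 3 ≤ (1 / ε S) ^ 3 := by gcongr
  have : 0 ≤ 2 / ε S ^ 2 * ((G S).2 : ℝ) := by positivity
  simp only [pow_zero, mul_one]
  push_cast
  linarith

theorem iterate_sizeStep_mono (hε : ∀ t, ε t ∈ Set.Ioo (0 : ℝ) (1 / 2)) (hanti : Antitone ε)
    (hG : Monotone G) : Monotone fun i => (sizeStep ε G)^[i] (0, 2) :=
  (sizeStep_mono hε hanti hG).monotone_iterate_of_le_map (le_sizeStep hε _)

theorem iterate_sizeStep_le (hε : ∀ t, ε t ∈ Set.Ioo (0 : ℝ) (1 / 2)) (hanti : Antitone ε)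
    (hG : Monotone G) (i : ℕ) :
    (sizeStep ε G)^[i] (0, 2) ≤ sizeBound 2 50 0 ε G (i + 1) := by
  induction i with
  | zero => exact le_sizeStep hε _
  | succ i ih =>
    rw [Function.iterate_succ_apply', sizeBound_succ]
    exact sizeStep_mono hε hanti hG ih

end Sizes

theorem exists_two_pow_near {ε : ℝ} (hε : ε ∈ Set.Ioo (0 : ℝ) (1 / 2)) :
    ∃ q : ℕ, 2 / ε < 2 ^ q ∧ (2 : ℝ) ^ q ≤ 4 / ε := by
  have h1 : 1 ≤ 2 / ε := by
    rw [le_div_iff₀ hε.1]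
    linarith [hε.2]
  obtain ⟨q, hq, hq'⟩ := exists_nat_pow_near h1 one_lt_two
  refine ⟨q + 1, hq', ?_⟩
  calc (2 : ℝ) ^ (q + 1) = 2 * 2 ^ q := by ring
    _ ≤ 2 * (2 / ε) := by gcongr
    _ = 4 / ε := by ring

/-! ### The rounds of the construction -/

variable {X : Type*} [Fintype X] {D : X → ℝ} {g : X → unitInterval} {q t : ℕ} {N : X → ℕ}
  {F : Set (X → unitInterval)} {W : Set (X → Bool)} {ε : ℕ × ℕ → ℝ} {G : ℕ × ℕ → ℕ × ℕ}

theorem Boosted.simulator_mem_simClass (hD : D ∈ stdSimplex ℝ X) {S : ℕ × ℕ}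
    (hε : ε S ∈ Set.Ioo (0 : ℝ) (1 / 2)) (hq : (2 : ℝ) ^ q ≤ 4 / ε S)
    (h : Boosted D g F (G S) (ε S) q t W N) :
    h.holds.simulator ∈ simClass F (sizeStep ε G S) := by
  have ht := h.steps_le hD hε.1
  have h0 := hε.1
  refine h.holds.mem_simClass (Nat.le_floor ?_) (Nat.le_floor ?_) fun x => rfl
  · push_cast
    gcongr
  · simp only [pow_zero, mul_one]
    push_cast
    have h2 : (2 : ℝ) ≤ 1 / ε S := by
      rw [le_div_iff₀ h0]
      linarith [hε.2]
    calc (2 : ℝ) + t * ((G S).2 + 3 * 2 ^ q) + 3 * (2 ^ q * 2 ^ q)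
        ≤ 2 + 2 / ε S ^ 2 * ((G S).2 + 3 * (4 / ε S)) + 3 * ((4 / ε S) * (4 / ε S)) := by
          gcongr
      _ = 2 / ε S ^ 2 * (G S).2 + (2 + 24 * (1 / ε S) ^ 3 + 48 * (1 / ε S) ^ 2) := by ring
      _ ≤ 2 / ε S ^ 2 * (G S).2 + 50 * (1 / ε S) ^ 3 := by
          generalize 1 / ε S = r at h2
          have h3 : (2 : ℝ) ^ 3 ≤ r ^ 3 := by gcongr
          have h4 : 2 * r ^ 2 ≤ r * r ^ 2 := by gcongr
          linarith

/-- Passing to larger parameters `s` and a smaller `ε`: the corrections made so far cost less and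
gained more than the new parameters allow for. -/
theorem Boosted.refine {s s' : ℕ × ℕ} {e e' : ℝ} (h : Boosted D g F s e q t W N) (hs : s ≤ s')
    (he' : 0 < e') (he : e' ≤ e) (r : ℕ) :
    Boosted D g F s' e' (q + r) t W fun x => N x * 2 ^ r := by
  refine ⟨(h.holds.refine r).mono (Nat.mul_le_mul_left _ hs.1) ?_, ?_⟩
  · gcongr
    · exact hs.2
    · exact one_le_two
    · omega
  · rw [potential_refine]
    refine le_trans ?_ h.drop
    gcongr

/-- The state at the start of a round with parameter `S`, when `i` rounds have lowered the potential
by `α` each: the current simulator belongs to `simClass F S`. -/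
def RoundState (D : X → ℝ) (g : X → unitInterval) (F : Set (X → unitInterval))
    (ε : ℕ × ℕ → ℝ) (G : ℕ × ℕ → ℕ × ℕ) (α : ℝ) (i : ℕ) (S : ℕ × ℕ) : Prop :=
  ∃ q t W N, ∃ h : Boosted D g F (G S) (ε S) q t W N, 2 / ε S < 2 ^ q ∧ (2 : ℝ) ^ q ≤ 4 / ε S ∧
    h.holds.simulator ∈ simClass F S ∧ potential D g q N ≤ 1 / 4 - i * α

/-- The initial simulator is the constant `1 / 2`, which takes two gates. -/
theorem roundState_zero (hD : D ∈ stdSimplex ℝ X) (hε : ∀ t, ε t ∈ Set.Ioo (0 : ℝ) (1 / 2))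
    (α : ℝ) : RoundState D g F ε G α 0 (0, 2) := by
  obtain ⟨q, hq, hq'⟩ := exists_two_pow_near (hε (0, 2))
  have hq0 : q ≠ 0 := by
    rintro rfl
    rw [div_lt_iff₀ (hε _).1] at hq
    linarith [(hε (0, 2)).2]
  obtain ⟨r, rfl⟩ := Nat.exists_eq_succ_of_ne_zero hq0
  obtain ⟨W, -, hW, hc⟩ := (computes_empty (F := F)).formulas 2
    (v := fun j _ => decide (j = 1)) fun j _ => IsFormula.const (decide (j = 1))
  have hmem : ∀ a : Bool, (fun _ : X => a) ∈ W := by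
    rintro (_ | _)
    exacts [hW 0 (by omega), hW 1 (by omega)]
  have hval : ((2 ^ r : ℕ) : ℝ) / 2 ^ (r + 1) = 1 / 2 := by
    rw [pow_succ]
    push_cast
    field_simp
  have hpot : potential D g (r + 1) (fun _ => 2 ^ r) ≤ 1 / 4 := by
    rw [← expect_const hD (1 / 4)]
    refine expect_mono hD fun x => ?_
    rw [hval]
    nlinarith [(g x).2.1, (g x).2.2]
  have hh : Holds F (r + 1) 0 2 W fun _ => 2 ^ r :=
    ⟨fun x => Nat.pow_le_pow_right two_pos r.le_succ, hc, fun j _ => hmem _⟩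
  refine ⟨r + 1, 0, W, fun _ => 2 ^ r, ⟨hh.mono (by omega) (by omega), by simpa using hpot⟩, hq,
    hq', ?_, by simpa using hpot⟩
  refine hc.mem_simClass le_rfl le_rfl (b := fun (i : Fin 2) _ => decide (i = 1))
    (fun i => hmem _) fun x => ?_
  change ((2 ^ r : ℕ) : ℝ) / 2 ^ (r + 1) = _
  rw [hval]
  simp [ofBits, Fin.sum_univ_two]

/-- There is a pair of simulators of sizes `S` and `sizeStep ε G S` that are close to each other, the
second one being regular for distinguishers of size `G S`. -/
def HasSupersimulator (D : X → ℝ) (g : X → unitInterval) (F : Set (X → unitInterval))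
    (ε : ℕ × ℕ → ℝ) (G : ℕ × ℕ → ℕ × ℕ) (α : ℝ) (S : ℕ × ℕ) : Prop :=
  ∃ h ∈ simClass F S, ∃ h' ∈ simClass F (sizeStep ε G S),
    expect D (fun x => ((h x : ℝ) - h' x) ^ 2) ≤ α + 2 * ε S ∧
    IsRegular D (simClass F (G S)) (ε S) g h'

theorem RoundState.next (hD : D ∈ stdSimplex ℝ X) (hε : ∀ t, ε t ∈ Set.Ioo (0 : ℝ) (1 / 2))
    (hanti : Antitone ε) (hG : Monotone G) {α : ℝ} {i : ℕ} {S : ℕ × ℕ} (hS : S ≤ sizeStep ε G S)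
    (h : RoundState D g F ε G α i S) :
    HasSupersimulator D g F ε G α S ∨ RoundState D g F ε G α (i + 1) (sizeStep ε G S) := by
  obtain ⟨q, t, W, N, h, hq, hq', hmem, hpot⟩ := h
  obtain ⟨t', W', N', hWW', h', hcorr⟩ := h.exists_corr_le hD (hε S).1 hq.le hq'
  have hmem' := h'.simulator_mem_simClass hD (hε S) hq'
  by_cases hclose :
      expect D (fun x => ((h.holds.simulator x : ℝ) - h'.holds.simulator x) ^ 2) ≤ α + 2 * ε S
  · exact Or.inl ⟨_, hmem, _, hmem', hclose, isRegular_of_corr_le (hε S).1 h'.holds hcorr⟩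
  · right
    have hpyth := expect_sq_sub_le h.holds h'.holds hWW' fun b hb => hcorr b (available_of_mem hb)
    obtain ⟨q₁, hq₁, hq₁'⟩ := exists_two_pow_near (hε (sizeStep ε G S))
    have hεle := hanti hS
    have hε₁ := (hε (sizeStep ε G S)).1
    have hqq : q ≤ q₁ := by
      have : (2 : ℝ) ^ q < 2 ^ (q₁ + 1) := by
        calc (2 : ℝ) ^ q ≤ 4 / ε S := hq'
          _ ≤ 4 / ε (sizeStep ε G S) := by gcongr
          _ = 2 / ε (sizeStep ε G S) * 2 := by ring
          _ < 2 ^ q₁ * 2 := by gcongr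
          _ = 2 ^ (q₁ + 1) := by ring
      exact Nat.lt_succ_iff.1 ((pow_lt_pow_iff_right₀ one_lt_two).1 this)
    obtain ⟨r, rfl⟩ := Nat.exists_eq_add_of_le hqq
    refine ⟨q + r, t', W', _, h'.refine (hG hS) hε₁ hεle r, hq₁, hq₁', ?_, ?_⟩
    · convert hmem' using 1
      funext x
      refine Subtype.ext ?_
      simp only [Holds.simulator, pow_add]
      push_cast
      field_simp
    · rw [potential_refine]
      push_cast
      linarith

theorem exists_hasSupersimulator (hD : D ∈ stdSimplex ℝ X)
    (hε : ∀ t, ε t ∈ Set.Ioo (0 : ℝ) (1 / 2)) (hanti : Antitone ε) (hG : Monotone G) {α : ℝ}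
    {n : ℕ} (hn : 1 / 4 < n * α) :
    ∃ i < n, HasSupersimulator D g F ε G α ((sizeStep ε G)^[i] (0, 2)) := by
  by_contra! hcon
  have key : ∀ i ≤ n, RoundState D g F ε G α i ((sizeStep ε G)^[i] (0, 2)) := by
    intro i
    induction i with
    | zero => exact fun _ => roundState_zero hD hε α
    | succ i ih =>
      intro hi
      have hle := iterate_sizeStep_mono hε hanti hG i.le_succ
      simp only [Nat.succ_eq_add_one, Function.iterate_succ_apply'] at hle ⊢
      exact ((ih (by omega)).next hD hε hanti hG hle).resolve_left (hcon i hi)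
  obtain ⟨q, t, W, N, -, -, -, -, hpot⟩ := key n le_rfl
  linarith [potential_nonneg (g := g) (q := q) (N := N) hD]

end Supersimulator

theorem mainTheorem3 :
    ∃ (A B C : ℝ) (p : ℕ), 0 < A ∧ 0 < B ∧ 0 < C ∧
      ∀ (X : Type*) [Fintype X] (D : X → ℝ), D ∈ stdSimplex ℝ X →
      ∀ (F : Set (X → unitInterval)) (g : X → unitInterval)
        (ε : ℕ × ℕ → ℝ), (∀ t, ε t ∈ Set.Ioo (0 : ℝ) (1 / 2)) → Antitone ε →
      ∀ α ∈ Set.Ioo (0 : ℝ) (1 / 2),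
      ∀ G : ℕ × ℕ → ℕ × ℕ, Monotone G →
        ∃ s s' : ℕ × ℕ,
          ∃ h ∈ Supersimulator.simClass F s, ∃ h' ∈ Supersimulator.simClass F s',
            Supersimulator.expect D (fun x => ((h x : ℝ) - h' x) ^ 2) ≤ α + C * ε s ∧
            Supersimulator.IsRegular D (Supersimulator.simClass F (G s)) (ε s) g h' ∧
            s ≤ Supersimulator.sizeBound A B p ε G ⌊1 / α⌋₊ ∧
            s' ≤ Supersimulator.sizeBound A B p ε G ⌊1 / α⌋₊ := by
  refine ⟨2, 50, 2, 0, by norm_num, by norm_num, by norm_num, ?_⟩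
  intro X _ D hD F g ε hε hanti α hα G hG
  have h2 : 2 ≤ ⌊1 / α⌋₊ := by
    refine Nat.le_floor ?_
    rw [le_div_iff₀ hα.1]
    push_cast
    linarith [hα.2]
  -- One of the `⌊1 / α⌋` steps of `sizeBound` pays for the two gates of the initial simulator. The
  -- remaining rounds suffice because the initial potential is `1 / 4` rather than `1`.
  obtain ⟨m, hm⟩ := Nat.exists_eq_add_of_le' h2
  have hmα : 1 / 4 < ((m + 1 : ℕ) : ℝ) * α := by
    have hlt := Nat.lt_floor_add_one (1 / α)
    rw [hm, div_lt_iff₀ hα.1] at hlt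
    have := mul_nonneg m.cast_nonneg hα.1.le
    push_cast at hlt ⊢
    linarith
  obtain ⟨i, hi, h, hh, h', hh', hclose, hreg⟩ :=
    Supersimulator.exists_hasSupersimulator (F := F) (g := g) hD hε hanti hG hmα
  have hbound : ∀ j ≤ m + 1, (Supersimulator.sizeStep ε G)^[j] (0, 2) ≤
      Supersimulator.sizeBound 2 50 0 ε G ⌊1 / α⌋₊ := by
    intro j hj
    rw [hm]
    exact (Supersimulator.iterate_sizeStep_mono hε hanti hG hj).trans
      (Supersimulator.iterate_sizeStep_le hε hanti hG (m + 1))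
  refine ⟨_, _, h, hh, h', hh', hclose, hreg, hbound i hi.le, ?_⟩
  rw [← Function.iterate_succ_apply' (Supersimulator.sizeStep ε G)]
  exact hbound (i + 1) hi
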